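/- Let $X$ be a $\sigma$-compact topological space and $\lambda$ a Borel probability measure on $X$ that is inner regular, i.e. $\lambda(B)=\sup\{\lambda(C) : C\subset B \text{ compact and Borel}\}$ for every Borel set $B$ (this is automatic if $X$ is metrizable). Let $f:X\to X$ be a Borel measurable map for which $\lambda$ is quasi-invariant ($f_*\lambda\ll\lambda$), and suppose that $f$ is ergodic and conservative with respect to $\lambda$. A $\lambda$-partition of $X$ is a (finite or infinite) countable collection $\mathcal G$ of pairwise disjoint $\sigma$-compact Borel sets $I$ with $0<\lambda(I)<\infty$ and $\lambda\big(X\setminus\bigcup_{I\in\mathcal G}I\big)=0$. For a $\lambda$-partition $\mathcal G$, let $\mathcal M_s(\mathcal G,f)$ be the set of all $\sigma$-finite Borel measures $\mu\ll\lambda$ on $X$ such that for every $I\in\mathcal G$ there is a $K>0$ with 1. $\frac1K\le\mu(I)\le K$; 2. for all $n\ge 0$, $0<\mu(f^{-n}(I))<\infty$, and for all measurable $A\subset I$ $$\frac1K\,\frac{\lambda(A)}{\lambda(I)}\le\frac{\mu(f^{-n}(A))}{\mu(f^{-n}(I))}\le K\,\frac{\lambda(A)}{\lambda(I)};$$ and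 such that $\sup_{n\ge0}\mu(f^{-n}(I))<\infty$ for every $I\in\mathcal G$. Then $f$ has a nonzero $\sigma$-finite invariant measure that is absolutely continuous with respect to $\lambda$ if and only if there is a $\lambda$-partition $\mathcal G$ of $X$ with $\mathcal M_s(\mathcal G,f)\neq\emptyset$. -/

import Mathlib

open MeasureTheory Set
open scoped ENNReal NNReal

/-- A countable family of pairwise disjoint Borel, σ-compact sets of positive finite `lam`-measure
that covers `lam`-almost all of `X`. The family may be finite or infinite. -/
structure IsLambdaPartition {X : Type*} [TopologicalSpace X] [MeasurableSpace X]
    (lam : Measure X) (G : Set (Set X)) : Prop where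
  countable : G.Countable
  pairwiseDisjoint : G.PairwiseDisjoint id
  measurableSet : ∀ I ∈ G, MeasurableSet I
  isSigmaCompact : ∀ I ∈ G, IsSigmaCompact I
  measure_pos : ∀ I ∈ G, 0 < lam I
  measure_lt_top : ∀ I ∈ G, lam I < ∞
  measure_compl : lam (⋃₀ G)ᶜ = 0

/-- The density of `ν` with respect to `lam` has, on the set `I` of finite `ν`-measure,
distortion bounded by `K`. -/
structure HasDistortionBoundedBy {X : Type*} [MeasurableSpace X]
    (lam ν : Measure X) (I : Set X) (K : ℝ≥0) : Prop where
  absolutelyContinuous : ν ≪ lam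
  measure_lt_top : ν I < ∞
  lower : ∀ A ⊆ I, MeasurableSet A → (K : ℝ≥0∞)⁻¹ * (lam A / lam I) ≤ ν A / ν I
  upper : ∀ A ⊆ I, MeasurableSet A → ν A / ν I ≤ K * (lam A / lam I)

/-- Property m1: `μ(I) ∈ [1/K, K]`. -/
def PropM1 {X : Type*} [MeasurableSpace X] (μ : Measure X) (I : Set X) (K : ℝ≥0) : Prop :=
  μ I ∈ Icc (K : ℝ≥0∞)⁻¹ (K : ℝ≥0∞)

/-- Property m2: all `μ(f⁻ⁿ(I))` are positive and finite, and all push-forwards of `μ` under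
the iterates of `f` have distortion bounded by `K` on `I`. -/
def PropM2 {X : Type*} [MeasurableSpace X] (lam : Measure X) (f : X → X) (μ : Measure X)
    (I : Set X) (K : ℝ≥0) : Prop :=
  ∀ n : ℕ, 0 < μ (f^[n] ⁻¹' I) ∧ μ (f^[n] ⁻¹' I) < ∞ ∧
    HasDistortionBoundedBy lam (μ.map f^[n]) I K

/-- Property m3: `sup_n μ(f⁻ⁿ(I)) < ∞`. -/
def PropM3 {X : Type*} [MeasurableSpace X] (f : X → X) (μ : Measure X) (I : Set X) : Prop :=
  ⨆ n : ℕ, μ (f^[n] ⁻¹' I) < ∞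

/-- The set `𝓜(G, f)` of σ-finite measures with m1 and m2 on every element of `G`. -/
def MeasM {X : Type*} [MeasurableSpace X] (lam : Measure X) (G : Set (Set X)) (f : X → X) :
    Set (Measure X) :=
  {μ | SigmaFinite μ ∧ ∀ I ∈ G, ∃ K : ℝ≥0, 0 < K ∧ PropM1 μ I K ∧ PropM2 lam f μ I K}

/-- The set `𝓜_s(G, f)` of the elements of `𝓜(G, f)` with m3 on every element of `G`. -/
def MeasMs {X : Type*} [MeasurableSpace X] (lam : Measure X) (G : Set (Set X)) (f : X → X) :
    Set (Measure X) :=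
  {μ | μ ∈ MeasM lam G f ∧ ∀ I ∈ G, PropM3 f μ I}

/-- `μ` is a (nonzero) σ-finite, `lam`-absolutely continuous, `f`-invariant measure. -/
structure IsAcim {X : Type*} [MeasurableSpace X] (lam : Measure X) (f : X → X)
    (μ : Measure X) : Prop where
  ne_zero : μ ≠ 0
  sigmaFinite : SigmaFinite μ
  absolutelyContinuous : μ ≪ lam
  invariant : MeasurePreserving f μ μ

/-! Let `μ` satisfy m1–m3, fix `J` in the partition and put `S N = ∑ i < N, μ (f⁻ⁱ J)`. Recurrence
forces `S N → ∞`. The averages `m N = (S N)⁻¹ ∑ i < N, f^i_* μ` are, for large `N`, bounded by `c_I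
* lam` on each `I`: m2 reduces this to `A = I`, and `eventually_sum_measure_preimage_le` compares
`I` with `J`. Domination makes ultrafilter limits countably additive on each `I`; their sum `ν`
satisfies `ν ≪ lam` and `ν J = 1`. With infinitely many elements mass may escape, so passing to the
limit only yields `f_* ν ≤ ν`; in `map_eq_self_of_map_le` conservativity and ergodicity turn this
into equality. Conversely, an invariant `μ ≪ lam` is equivalent to `lam`, so its density is positive
and finite almost everywhere. Partition `X` into σ-compact sets on which the density is bounded
above and below; `μ` itself then has m1–m3. -/

open Filter Topology

/-! ### Recurrence, and invariance from sub-invariance. -/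

section Recurrence

variable {X : Type*} [MeasurableSpace X] {lam : Measure X} {f : X → X}

/-- For an ergodic conservative map almost every orbit visits a given set of positive measure
infinitely often. -/
theorem ae_frequently_iterate_mem (herg : QuasiErgodic f lam) (hcons : Conservative f lam)
    {B : Set X} (hB : MeasurableSet B) (hpos : lam B ≠ 0) :
    ∀ᵐ x ∂lam, ∃ᶠ n in atTop, f^[n] x ∈ B := by
  have hf : Measurable f := herg.measurable
  set E : Set X := {x | ∃ᶠ n in atTop, f^[n] x ∈ B} with hE
  have hEm : MeasurableSet E := by
    have : E = limsup (fun n => f^[n] ⁻¹' B) atTop := by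
      ext x
      rw [mem_limsup_iff_frequently_mem]
      rfl
    rw [this]
    exact MeasurableSet.measurableSet_limsup fun n => hf.iterate n hB
  have hinv : f ⁻¹' E = E := by
    ext x
    simp only [hE, mem_preimage, mem_ofPred_eq, ← Function.iterate_succ_apply]
    conv_rhs => rw [← map_add_atTop_eq_nat 1, frequently_map]
  rcases herg.toPreErgodic.ae_mem_or_ae_notMem hEm hinv with h | h
  · exact h
  -- If `E` were null, so would be `B`, since almost every point of `B` returns infinitely often.
  · refine absurd ?_ hpos
    rw [measure_eq_zero_iff_ae_notMem]
    filter_upwards [h, hcons.ae_mem_imp_frequently_image_mem hB.nullMeasurableSet] with x hx hx' hxB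
    exact hx (hx' hxB)

/-- A nonzero absolutely continuous measure gives infinite total mass to the preimages
under all iterates of a set of positive measure. -/
theorem tsum_measure_preimage_iterate_eq_top (herg : QuasiErgodic f lam)
    (hcons : Conservative f lam) {B : Set X} (hB : MeasurableSet B) (hpos : lam B ≠ 0)
    {ν : Measure X} (hν : ν ≪ lam) (h0 : ν ≠ 0) :
    ∑' n : ℕ, ν (f^[n] ⁻¹' B) = ∞ := by
  by_contra hfin
  -- Borel–Cantelli.
  have h1 := measure_setOfPred_frequently_eq_zero (μ := ν) (p := fun n x => f^[n] x ∈ B) hfin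
  have h2 := hν.ae_le (ae_frequently_iterate_mem herg hcons hB hpos)
  apply h0
  rw [← ae_eq_bot, ← empty_mem_iff_bot]
  have h3 : ∀ᵐ x ∂ν, ¬ ∃ᶠ n in atTop, f^[n] x ∈ B := measure_eq_zero_iff_ae_notMem.1 h1
  filter_upwards [h2, h3] with x hx hx'
  exact hx' hx

/-- Some iterate of `f` maps a part of positive measure of `A` into `B`. -/
theorem exists_measure_inter_preimage_iterate_ne_zero (herg : QuasiErgodic f lam)
    (hcons : Conservative f lam) {A B : Set X} (hA : lam A ≠ 0) (hB : MeasurableSet B)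
    (hpos : lam B ≠ 0) : ∃ k : ℕ, lam (A ∩ f^[k] ⁻¹' B) ≠ 0 := by
  by_contra! h
  have h1 : lam (⋃ k : ℕ, A ∩ f^[k] ⁻¹' B) = 0 := measure_iUnion_null h
  apply hA
  rw [measure_eq_zero_iff_ae_notMem] at h1 ⊢
  filter_upwards [h1, ae_frequently_iterate_mem herg hcons hB hpos] with x hx hx' hxA
  obtain ⟨k, hk⟩ := hx'.exists
  exact hx (mem_iUnion.2 ⟨k, hxA, hk⟩)

/-- An absolutely continuous invariant measure is equivalent to the reference measure. -/
theorem IsAcim.absolutelyContinuous_symm {μ : Measure X} (hμ : IsAcim lam f μ)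
    (herg : QuasiErgodic f lam) (hcons : Conservative f lam) : lam ≪ μ := by
  refine Measure.AbsolutelyContinuous.mk fun S hS hS0 => ?_
  by_contra hpos
  have h := tsum_measure_preimage_iterate_eq_top herg hcons hS hpos
    hμ.absolutelyContinuous hμ.ne_zero
  simp [(hμ.invariant.iterate _).measure_preimage hS.nullMeasurableSet, hS0] at h

/-- A σ-finite absolutely continuous measure that decreases under push-forward is invariant. -/
theorem map_eq_self_of_map_le (herg : QuasiErgodic f lam) (hcons : Conservative f lam)
    {ν : Measure X} [SigmaFinite ν] (hν : ν ≪ lam) (hle : ν.map f ≤ ν)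
    {B : Set X} (hB : MeasurableSet B) (hpos : lam B ≠ 0) (hfin : ν B ≠ ∞) :
    ν.map f = ν := by
  have hf : Measurable f := herg.measurable
  have : SigmaFinite (ν.map f) := Measure.sigmaFinite_of_le ν hle
  set u := (ν.map f).rnDeriv ν with hu
  have hum : Measurable u := Measure.measurable_rnDeriv _ _
  have hmap : ν.withDensity u = ν.map f :=
    Measure.withDensity_rnDeriv_eq _ _ (Measure.absolutelyContinuous_of_le hle)
  have hu1 : u ≤ᵐ[ν] 1 := Measure.rnDeriv_le_one_of_le hle
  -- The defect `ν - f_* ν`, realised through its density.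
  set δ := ν.withDensity (1 - u) with hδ
  have hsum : ν.map f + δ = ν := by
    rw [← hmap, hδ, ← withDensity_add_left hum]
    conv_rhs => rw [← withDensity_one (μ := ν)]
    refine withDensity_congr_ae ?_
    filter_upwards [hu1] with x hx
    simpa using add_tsub_cancel_of_le hx
  -- Telescoping: `δ` of the `i`-th preimage is the drop of `ν` from the `i`-th to the next. Hence
  -- the sum over all `i` is at most `ν B < ∞`, impossible for `δ ≠ 0`.
  have hstep : ∀ n : ℕ, ∑ i ∈ Finset.range n, δ (f^[i] ⁻¹' B) + ν (f^[n] ⁻¹' B) = ν B := by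
    intro n
    induction n with
    | zero => simp
    | succ n ih =>
      have h := congrArg (fun m : Measure X => m (f^[n] ⁻¹' B)) hsum
      simp only [Measure.add_apply, Measure.map_apply hf (hf.iterate n hB), ← preimage_comp,
        ← Function.iterate_succ] at h
      rw [Finset.sum_range_succ, add_assoc, add_comm (δ _), h, ih]
  have hδ0 : δ = 0 := by
    by_contra h0
    have h := tsum_measure_preimage_iterate_eq_top herg hcons hB hpos
      ((withDensity_absolutelyContinuous ν (1 - u)).trans hν) h0
    refine hfin (top_le_iff.1 (h ▸ ?_))
    refine ENNReal.tsum_le_of_sum_range_le fun n => ?_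
    rw [← hstep n]
    exact le_self_add
  rwa [hδ0, add_zero] at hsum

end Recurrence

/-! ### Setwise limits of dominated measures. -/

section LimitMeasure

variable {X : Type*} [MeasurableSpace X]

/-- Measures that on `I` are uniformly dominated by a finite measure converge setwise on `I`
along every ultrafilter. -/
theorem exists_measure_tendsto_ultrafilter {ι : Type*} (U : Ultrafilter ι) (m : ι → Measure X)
    (lam : Measure X) [IsFiniteMeasure lam] {I : Set X} (hI : MeasurableSet I) {c : ℝ≥0∞}
    (hc : c ≠ ∞)
    (hm : ∀ᶠ N in (U : Filter ι), ∀ A ⊆ I, MeasurableSet A → m N A ≤ c * lam A) :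
    ∃ ν : Measure X, ∀ A, MeasurableSet A →
      Tendsto (fun N => m N (A ∩ I)) U (𝓝 (ν A)) := by
  -- `ℝ≥0∞` is compact, so the limit along an ultrafilter exists for every set.
  set L : Set X → ℝ≥0∞ := fun A => (U.map fun N => m N (A ∩ I)).lim with hL
  have hlim : ∀ A, Tendsto (fun N => m N (A ∩ I)) U (𝓝 (L A)) := fun A =>
    Ultrafilter.le_nhds_lim (U.map fun N => m N (A ∩ I))
  have hbound : ∀ A, MeasurableSet A → L A ≤ c * lam A := fun A hA =>
    le_of_tendsto (hlim A) <| hm.mono fun N hN =>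
      (hN _ inter_subset_right (hA.inter hI)).trans <| by gcongr; exact inter_subset_left
  have hempty : L ∅ = 0 := by simpa using hbound ∅ .empty
  have hunion : ∀ A B, MeasurableSet B → Disjoint A B → L (A ∪ B) = L A + L B := by
    intro A B hB hAB
    refine tendsto_nhds_unique (hlim _) (((hlim A).add (hlim B)).congr fun N => ?_)
    rw [union_inter_distrib_right, measure_union
      (hAB.mono inter_subset_left inter_subset_left) (hB.inter hI)]
  have hsum : ∀ s : ℕ → Set X, (∀ i, MeasurableSet (s i)) → Pairwise (Function.onFun Disjoint s) →
      L (⋃ i, s i) = ∑' i, L (s i) := by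
    intro s hs hd
    -- Finite additivity passes to the limit; countable additivity needs `L (T n) → 0` on tails,
    -- which domination by the finite measure `lam` provides.
    set T : ℕ → Set X := fun n => ⋃ i, s (i + n) with hT
    have hTm : ∀ n, MeasurableSet (T n) := fun n => .iUnion fun i => hs _
    have hsplit : ∀ n, L (⋃ i, s i) = ∑ i ∈ Finset.range n, L (s i) + L (T n) := by
      intro n
      induction n with
      | zero => simp [hT]
      | succ n ih =>
        have h1 : T n = s n ∪ T (n + 1) := by
          ext x
          simp only [hT, mem_iUnion, mem_union]
          constructor
          · rintro ⟨i, hi⟩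
            rcases i with _ | i
            · left; simpa using hi
            · right; exact ⟨i, by rwa [show i + (n + 1) = i + 1 + n by omega]⟩
          · rintro (h | ⟨i, hi⟩)
            · exact ⟨0, by simpa using h⟩
            · exact ⟨i + 1, by rwa [show i + 1 + n = i + (n + 1) by omega]⟩
        have h2 : Disjoint (s n) (T (n + 1)) :=
          disjoint_iUnion_right.2 fun i => hd (by omega)
        rw [ih, h1, hunion _ _ (hTm _) h2, Finset.sum_range_succ, add_assoc]
    have hlamT : Tendsto (fun n => lam (T n)) atTop (𝓝 0) := by
      have h : ∀ n, lam (T n) = ∑' i, lam (s (i + n)) := fun n =>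
        measure_iUnion (fun i j hij => hd (by omega)) fun i => hs _
      simp_rw [h]
      refine ENNReal.tendsto_sum_nat_add (fun i => lam (s i)) ?_
      rw [← measure_iUnion hd hs]
      exact measure_ne_top _ _
    have hLT : Tendsto (fun n => L (T n)) atTop (𝓝 0) := by
      have h := ENNReal.Tendsto.const_mul hlamT (Or.inr hc)
      rw [mul_zero] at h
      exact tendsto_of_tendsto_of_tendsto_of_le_of_le tendsto_const_nhds h
        (fun _ => zero_le) fun n => hbound _ (hTm n)
    have h := (ENNReal.tendsto_nat_tsum fun i => L (s i)).add hLT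
    rw [add_zero] at h
    exact tendsto_nhds_unique (tendsto_const_nhds.congr hsplit) h
  refine ⟨Measure.ofMeasurable (fun A _ => L A) hempty fun s hs hd => hsum s hs hd, fun A hA => ?_⟩
  rw [Measure.ofMeasurable_apply A hA]
  exact hlim A

end LimitMeasure

/-! ### σ-compact approximation from inside. -/

section SigmaCompact

variable {X : Type*} [TopologicalSpace X] [MeasurableSpace X]

/-- Inner regularity yields σ-compact Borel subsets of full measure. -/
theorem exists_isSigmaCompact_subset_measure_eq {lam : Measure X}
    (hreg : lam.InnerRegularWRT (fun K => IsCompact K ∧ MeasurableSet K) MeasurableSet)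
    {B : Set X} (hB : MeasurableSet B) :
    ∃ D ⊆ B, MeasurableSet D ∧ IsSigmaCompact D ∧ lam D = lam B := by
  rcases eq_or_ne (lam B) 0 with h0 | h0
  · exact ⟨∅, empty_subset _, .empty, isSigmaCompact_empty, by simp [h0]⟩
  obtain ⟨r, -, hr, hlim⟩ := exists_seq_strictMono_tendsto' (pos_iff_ne_zero.2 h0)
  choose K hKB hK hlt using fun n => hreg hB (r n) (hr n).2
  refine ⟨⋃ n, K n, iUnion_subset hKB, .iUnion fun n => (hK n).2,
    isSigmaCompact_iUnion_of_isCompact _ fun n => (hK n).1, le_antisymm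
      (measure_mono (iUnion_subset hKB)) (le_of_tendsto' hlim fun n => ?_)⟩
  exact (hlt n).le.trans (measure_mono (subset_iUnion K n))

end SigmaCompact

/-! ### From a measure in `MeasMs` to an invariant measure. -/

section Backward

variable {X : Type*} [MeasurableSpace X] {lam : Measure X} {f : X → X}
  {G : Set (Set X)}

theorem IsLambdaPartition.nonempty [TopologicalSpace X] [NeZero lam]
    (hG : IsLambdaPartition lam G) : G.Nonempty := by
  by_contra h
  rw [not_nonempty_iff_eq_empty] at h
  have := hG.measure_compl
  simp [h, NeZero.ne lam] at this

/-- Measures that are uniformly dominated on each element of a partition and asymptotically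
decrease under push-forward accumulate at a measure that decreases under push-forward. -/
theorem IsLambdaPartition.exists_map_le [TopologicalSpace X] [IsFiniteMeasure lam]
    (hG : IsLambdaPartition lam G)
    (hf : Measure.QuasiMeasurePreserving f lam lam) (m : ℕ → Measure X)
    (hdom : ∀ I ∈ G, ∃ c : ℝ≥0∞, c ≠ ∞ ∧
      ∀ᶠ N in atTop, ∀ A ⊆ I, MeasurableSet A → m N A ≤ c * lam A)
    (hdec : ∀ I ∈ G, ∃ ε : ℕ → ℝ≥0∞, Tendsto ε atTop (𝓝 0) ∧
      ∀ A ⊆ I, MeasurableSet A → ∀ N, m N (f ⁻¹' A) ≤ m N A + ε N)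
    {J : Set X} (hJ : J ∈ G) (hone : ∀ᶠ N in atTop, m N J = 1) :
    ∃ ν : Measure X, SigmaFinite ν ∧ ν ≪ lam ∧ ν.map f ≤ ν ∧ ν J = 1 := by
  have hU : ((hyperfilter ℕ : Ultrafilter ℕ) : Filter ℕ) ≤ atTop := Nat.hyperfilter_le_atTop
  choose c hc hdom using hdom
  have : Countable G := hG.countable
  choose p hp using fun I : G => exists_measure_tendsto_ultrafilter (hyperfilter ℕ) m lam
    (hG.measurableSet I I.2) (hc I I.2) (hU (hdom I I.2))
  have hdisj : ∀ {I I' : G}, I ≠ I' → Disjoint (I : Set X) I' := fun {I I'} h =>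
    hG.pairwiseDisjoint I.2 I'.2 (Subtype.coe_injective.ne h)
  set ν := Measure.sum p with hν
  have hνA : ∀ A, MeasurableSet A → ν A = ∑' I, p I A := fun A hA => Measure.sum_apply _ hA
  have hle : ∀ (I : G) A, MeasurableSet A → p I A ≤ c I I.2 * lam A := fun I A hA =>
    le_of_tendsto (hp I A hA) <| Eventually.mono (hU (hdom I I.2)) fun N hN =>
      (hN _ inter_subset_right (hA.inter (hG.measurableSet I I.2))).trans <| by
        gcongr; exact inter_subset_left
  have hpinter : ∀ (I : G) A, MeasurableSet A → p I (A ∩ I) = p I A := fun I A hA =>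
    tendsto_nhds_unique (hp I _ (hA.inter (hG.measurableSet I I.2)))
      ((hp I A hA).congr fun N => by rw [inter_assoc, inter_self])
  have hνI : ∀ (I : G) (A : Set X), A ⊆ I → MeasurableSet A → ν A = p I A := by
    intro I A hAI hA
    rw [hνA A hA]
    refine tsum_eq_single I fun I' hI' => ?_
    rw [← hpinter I' A hA, ((hdisj hI').symm.mono_left hAI).inter_eq, measure_empty]
  have hac : ν ≪ lam := by
    refine Measure.AbsolutelyContinuous.mk fun A hA h0 => ?_
    rw [hνA A hA, ENNReal.tsum_eq_zero]
    intro I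
    simpa [h0] using hle I A hA
  have hsig : SigmaFinite ν := by
    refine Measure.sigmaFinite_of_countable (S := insert (⋃₀ G)ᶜ G) (hG.countable.insert _) ?_ ?_
    · rintro I (rfl | hI)
      · rw [hac hG.measure_compl]; exact ENNReal.zero_lt_top
      · rw [hνI ⟨I, hI⟩ I subset_rfl (hG.measurableSet I hI)]
        exact (hle ⟨I, hI⟩ I (hG.measurableSet I hI)).trans_lt
          (ENNReal.mul_lt_top (hc I hI).lt_top (hG.measure_lt_top I hI))
    · rw [sUnion_insert, compl_union_self]
  refine ⟨ν, hsig, hac, ?_, ?_⟩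
  · have hkey : ∀ (I : G) A, MeasurableSet A → ν (f ⁻¹' (A ∩ I)) ≤ p I A := by
      intro I A hA
      have hB : MeasurableSet (A ∩ I) := hA.inter (hG.measurableSet I I.2)
      have hfB := hf.measurable hB
      rw [hνA _ hfB, ENNReal.tsum_eq_iSup_sum]
      refine iSup_le fun F => ?_
      obtain ⟨ε, hε, hdec⟩ := hdec I I.2
      have h1 : Tendsto (fun N => ∑ I' ∈ F, m N (f ⁻¹' (A ∩ I) ∩ I')) (hyperfilter ℕ)
          (𝓝 (∑ I' ∈ F, p I' (f ⁻¹' (A ∩ I)))) :=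
        -- Limits commute only with finite sums; the supremum over `F` is why an inequality, not an
        -- equality, results.
        tendsto_finsetSum _ fun I' _ => hp I' _ hfB
      have h2 := (hp I A hA).add (hε.mono_left hU)
      rw [add_zero] at h2
      refine le_of_tendsto_of_tendsto' h1 h2 fun N => ?_
      refine le_trans ?_ (hdec _ inter_subset_right hB N)
      rw [← measure_biUnion_finset]
      · exact measure_mono (iUnion₂_subset fun _ _ => inter_subset_left)
      · intro I₁ _ I₂ _ h
        exact (hdisj h).mono inter_subset_right inter_subset_right
      · exact fun I' _ => hfB.inter (hG.measurableSet I' I'.2)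
    refine Measure.le_iff.2 fun A hA => ?_
    rw [Measure.map_apply hf.measurable hA, hνA A hA]
    have hcov : f ⁻¹' A ⊆ (⋃ I : G, f ⁻¹' (A ∩ I)) ∪ f ⁻¹' (⋃₀ G)ᶜ := by
      intro x hx
      by_cases h : f x ∈ ⋃₀ G
      · obtain ⟨I, hI, hxI⟩ := h
        exact Or.inl (mem_iUnion.2 ⟨⟨I, hI⟩, hx, hxI⟩)
      · exact Or.inr h
    have hnull : ν (f ⁻¹' (⋃₀ G)ᶜ) = 0 := hac (hf.preimage_null hG.measure_compl)
    calc ν (f ⁻¹' A) ≤ ν (⋃ I : G, f ⁻¹' (A ∩ I)) + ν (f ⁻¹' (⋃₀ G)ᶜ) :=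
          (measure_mono hcov).trans (measure_union_le _ _)
      _ ≤ ∑' I : G, ν (f ⁻¹' (A ∩ I)) := by
          rw [hnull, add_zero]; exact measure_iUnion_le _
      _ ≤ ∑' I : G, p I A := ENNReal.tsum_le_tsum fun I => hkey I A hA
  · rw [hνI ⟨J, hJ⟩ J subset_rfl (hG.measurableSet J hJ)]
    refine tendsto_nhds_unique (hp ⟨J, hJ⟩ J (hG.measurableSet J hJ)) ?_
    rw [inter_self]
    exact tendsto_const_nhds.congr' (Eventually.mono (hU hone) fun N hN => hN.symm)

theorem PropM2.measure_preimage_le {μ : Measure X} {I : Set X} {K : ℝ≥0}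
    (h : PropM2 lam f μ I K) (hf : Measurable f) (hI : MeasurableSet I) {A : Set X} (hAI : A ⊆ I)
    (hA : MeasurableSet A) (n : ℕ) :
    μ (f^[n] ⁻¹' A) ≤ K * (lam A / lam I) * μ (f^[n] ⁻¹' I) := by
  obtain ⟨h0, ht, hd⟩ := h n
  have := hd.upper A hAI hA
  rwa [Measure.map_apply (hf.iterate n) hA, Measure.map_apply (hf.iterate n) hI,
    ENNReal.div_le_iff h0.ne' ht.ne] at this

theorem PropM2.le_measure_preimage {μ : Measure X} {I : Set X} {K : ℝ≥0}
    (h : PropM2 lam f μ I K) (hf : Measurable f) (hI : MeasurableSet I) {A : Set X} (hAI : A ⊆ I)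
    (hA : MeasurableSet A) (n : ℕ) :
    (K : ℝ≥0∞)⁻¹ * (lam A / lam I) * μ (f^[n] ⁻¹' I) ≤ μ (f^[n] ⁻¹' A) := by
  obtain ⟨h0, ht, hd⟩ := h n
  have := hd.lower A hAI hA
  rwa [Measure.map_apply (hf.iterate n) hA, Measure.map_apply (hf.iterate n) hI,
    ENNReal.le_div_iff_mul_le (Or.inl h0.ne') (Or.inl ht.ne)] at this

/-- The sums of the measures of preimages grow at comparable rates for all partition elements. -/
theorem eventually_sum_measure_preimage_le (herg : QuasiErgodic f lam) (hcons : Conservative f lam)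
    {μ : Measure X} {I J : Set X} {K : ℝ≥0} (hI : MeasurableSet I) (hI0 : lam I ≠ 0)
    (hI' : lam I ≠ ∞) (h : PropM2 lam f μ I K) (hJ : MeasurableSet J) (hJ0 : lam J ≠ 0)
    (h3 : PropM3 f μ J)
    (htop : Tendsto (fun N => ∑ i ∈ Finset.range N, μ (f^[i] ⁻¹' J)) atTop (𝓝 ∞)) :
    ∃ R : ℝ≥0∞, R ≠ ∞ ∧ ∀ᶠ N in atTop, ∑ i ∈ Finset.range N, μ (f^[i] ⁻¹' I) ≤
      R * ∑ i ∈ Finset.range N, μ (f^[i] ⁻¹' J) := by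
  have hf : Measurable f := herg.measurable
  -- The part `B` of `I` is carried into `J` in `k` steps. By distortion at least the proportion `q`
  -- of `f⁻ⁿ I` lies in `f⁻ⁿ B`, hence in the preimage of `J` under `f^[n + k]`.
  obtain ⟨k, hk⟩ := exists_measure_inter_preimage_iterate_ne_zero herg hcons hI0 hJ hJ0
  set B := I ∩ f^[k] ⁻¹' J with hBdef
  have hB : MeasurableSet B := hI.inter (hf.iterate k hJ)
  set q : ℝ≥0∞ := (K : ℝ≥0∞)⁻¹ * (lam B / lam I) with hq
  have hq0 : q ≠ 0 := mul_ne_zero (ENNReal.inv_ne_zero.2 ENNReal.coe_ne_top)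
    (ENNReal.div_ne_zero.2 ⟨hk, hI'⟩)
  set M := ⨆ n : ℕ, μ (f^[n] ⁻¹' J) with hM
  have hM' : M ≠ ∞ := ne_of_lt h3
  have hterm : ∀ n, q * μ (f^[n] ⁻¹' I) ≤ μ (f^[n + k] ⁻¹' J) := fun n =>
    (h.le_measure_preimage hf hI inter_subset_left hB n).trans <| measure_mono fun x hx => by
      have := hx.2
      rwa [mem_preimage, ← Function.iterate_add_apply, add_comm] at this
  -- `K = 0` is not excluded here and would give `K⁻¹ = ∞`; m3 for `J` rules out `q = ∞`.
  have hqtop : q ≠ ∞ := by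
    intro hqt
    have h1 := hterm 0
    rw [hqt, ENNReal.top_mul (h 0).1.ne', top_le_iff] at h1
    exact hM' (top_le_iff.1 (h1 ▸ le_iSup (fun n => μ (f^[n] ⁻¹' J)) (0 + k)))
  -- The shift by `k` costs at most `k * M`, which the diverging sum for `J` eventually absorbs:
  -- hence the factor 2.
  refine ⟨q⁻¹ * 2, ENNReal.mul_ne_top (ENNReal.inv_ne_top.2 hq0) ENNReal.ofNat_ne_top, ?_⟩
  have hkM : (k : ℝ≥0∞) * M < ∞ := ENNReal.mul_lt_top (ENNReal.natCast_lt_top k) hM'.lt_top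
  filter_upwards [htop.eventually (lt_mem_nhds hkM)] with N hN
  rw [mul_assoc, ← ENNReal.div_eq_inv_mul, ENNReal.le_div_iff_mul_le (Or.inl hq0) (Or.inl hqtop),
    mul_comm, Finset.mul_sum]
  calc ∑ i ∈ Finset.range N, q * μ (f^[i] ⁻¹' I)
      ≤ ∑ i ∈ Finset.range N, μ (f^[i + k] ⁻¹' J) := Finset.sum_le_sum fun i _ => hterm i
    _ ≤ ∑ i ∈ Finset.range (k + N), μ (f^[i] ⁻¹' J) := by
        rw [Finset.sum_range_add]
        simp_rw [add_comm k]
        exact le_add_self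
    _ = ∑ i ∈ Finset.range N, μ (f^[i] ⁻¹' J) + ∑ i ∈ Finset.range k, μ (f^[N + i] ⁻¹' J) := by
        rw [add_comm k, Finset.sum_range_add]
    _ ≤ ∑ i ∈ Finset.range N, μ (f^[i] ⁻¹' J) + k * M := by
        gcongr
        simpa using Finset.sum_le_card_nsmul (Finset.range k) (fun i => μ (f^[N + i] ⁻¹' J)) M
          fun i _ => le_iSup (fun n => μ (f^[n] ⁻¹' J)) (N + i)
    _ ≤ 2 * ∑ i ∈ Finset.range N, μ (f^[i] ⁻¹' J) := by
        rw [two_mul]; gcongr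

theorem exists_isAcim_of_measMs [TopologicalSpace X] [IsProbabilityMeasure lam]
    (herg : QuasiErgodic f lam) (hcons : Conservative f lam) (hG : IsLambdaPartition lam G)
    {μ : Measure X} (hμ : μ ∈ MeasMs lam G f) : ∃ ν : Measure X, IsAcim lam f ν := by
  have hf : Measurable f := herg.measurable
  obtain ⟨⟨-, hM⟩, h3⟩ := hμ
  choose! K _ _ h2 using hM
  obtain ⟨J, hJ⟩ := hG.nonempty
  have hJm := hG.measurableSet J hJ
  have hJ0 := (hG.measure_pos J hJ).ne'
  -- The case `n = 0` of m2.
  have hμlam : μ ≪ lam := by simpa using (h2 J hJ 0).2.2.absolutelyContinuous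
  have hμ0 : μ ≠ 0 := by
    rintro rfl
    simpa using (h2 J hJ 0).1
  set S : ℕ → ℝ≥0∞ := fun N => ∑ i ∈ Finset.range N, μ (f^[i] ⁻¹' J) with hS
  have hStop : Tendsto S atTop (𝓝 ∞) := by
    rw [← tsum_measure_preimage_iterate_eq_top herg hcons hJm hJ0 hμlam hμ0]
    exact ENNReal.tendsto_nat_tsum _
  have hSfin : ∀ N, S N ≠ ∞ := fun N => (ENNReal.sum_lt_top.2 fun i _ => (h2 J hJ i).2.1).ne
  have hSpos : ∀ᶠ N in atTop, S N ≠ 0 :=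
    (hStop.eventually (lt_mem_nhds ENNReal.zero_lt_top)).mono fun N hN => hN.ne'
  set m : ℕ → Measure X := fun N => (S N)⁻¹ • ∑ i ∈ Finset.range N, μ.map f^[i] with hm
  have hmA : ∀ N A, MeasurableSet A →
      m N A = (S N)⁻¹ * ∑ i ∈ Finset.range N, μ (f^[i] ⁻¹' A) := by
    intro N A hA
    simp only [hm, Measure.smul_apply, Measure.coe_finsetSum, Finset.sum_apply, smul_eq_mul]
    congr 1
    exact Finset.sum_congr rfl fun i _ => Measure.map_apply (hf.iterate i) hA
  have hdom : ∀ I ∈ G, ∃ c : ℝ≥0∞, c ≠ ∞ ∧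
      ∀ᶠ N in atTop, ∀ A ⊆ I, MeasurableSet A → m N A ≤ c * lam A := by
    intro I hI
    have hIm := hG.measurableSet I hI
    have hI0 := (hG.measure_pos I hI).ne'
    obtain ⟨R, hR, hRN⟩ := eventually_sum_measure_preimage_le herg hcons hIm hI0
      (hG.measure_lt_top I hI).ne (h2 I hI) hJm hJ0 (h3 J hJ) hStop
    refine ⟨K I * (lam I)⁻¹ * R, ENNReal.mul_ne_top (ENNReal.mul_ne_top ENNReal.coe_ne_top
      (ENNReal.inv_ne_top.2 hI0)) hR, ?_⟩
    filter_upwards [hRN, hSpos] with N hN hN0 A hAI hA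
    rw [hmA N A hA]
    calc (S N)⁻¹ * ∑ i ∈ Finset.range N, μ (f^[i] ⁻¹' A)
        ≤ (S N)⁻¹ * ∑ i ∈ Finset.range N, K I * (lam A / lam I) * μ (f^[i] ⁻¹' I) := by
          gcongr with i
          exact (h2 I hI).measure_preimage_le hf hIm hAI hA i
      _ ≤ (S N)⁻¹ * (K I * (lam A / lam I) * (R * S N)) := by
          rw [← Finset.mul_sum]
          gcongr
      _ = (S N)⁻¹ * S N * (K I * (lam I)⁻¹ * R * lam A) := by
          rw [ENNReal.div_eq_inv_mul]; ring
      _ = K I * (lam I)⁻¹ * R * lam A := by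
          rw [ENNReal.inv_mul_cancel hN0 (hSfin N), one_mul]
  have hdec : ∀ I ∈ G, ∃ ε : ℕ → ℝ≥0∞, Tendsto ε atTop (𝓝 0) ∧
      ∀ A ⊆ I, MeasurableSet A → ∀ N, m N (f ⁻¹' A) ≤ m N A + ε N := by
    intro I hI
    -- Pulling back by `f` shifts the sum by one, adding at most the term of index `N`; m3 bounds it
    -- and `S N → ∞` makes it negligible.
    refine ⟨fun N => (S N)⁻¹ * ⨆ n : ℕ, μ (f^[n] ⁻¹' I), ?_, fun A hAI hA N => ?_⟩
    · have h := ENNReal.Tendsto.mul_const (b := ⨆ n : ℕ, μ (f^[n] ⁻¹' I))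
        (tendsto_inv_iff.2 hStop) (Or.inr (ne_of_lt (h3 I hI)))
      simpa using h
    · rw [hmA N A hA, hmA N _ (hf hA), ← mul_add]
      gcongr
      calc ∑ i ∈ Finset.range N, μ (f^[i] ⁻¹' (f ⁻¹' A))
          = ∑ i ∈ Finset.range N, μ (f^[i + 1] ⁻¹' A) := by
            simp_rw [← preimage_comp, ← Function.iterate_succ']
        _ ≤ ∑ i ∈ Finset.range (N + 1), μ (f^[i] ⁻¹' A) := by
            rw [Finset.sum_range_succ']; exact le_self_add
        _ ≤ _ := by
            rw [Finset.sum_range_succ]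
            gcongr
            exact (measure_mono (preimage_mono hAI)).trans
              (le_iSup (fun n => μ (f^[n] ⁻¹' I)) N)
  have hone : ∀ᶠ N in atTop, m N J = 1 := hSpos.mono fun N hN => by
    rw [hmA N J hJm]
    exact ENNReal.inv_mul_cancel hN (hSfin N)
  obtain ⟨ν, hνσ, hνlam, hνle, hνJ⟩ :=
    hG.exists_map_le herg.toQuasiMeasurePreserving m hdom hdec hJ hone
  refine ⟨ν, ?_, hνσ, hνlam, hf, map_eq_self_of_map_le herg hcons hνlam hνle hJm hJ0 ?_⟩
  · rintro rfl
    simp at hνJ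
  · simp [hνJ]

end Backward

/-! ### From an invariant measure to a partition. -/

section Forward

variable {X : Type*} [MeasurableSpace X] {lam : Measure X} {f : X → X}

/-- A countable measurable family exhausting the space up to a null set can be refined to a
partition into σ-compact sets. -/
theorem exists_isLambdaPartition_of_iUnion [TopologicalSpace X] [IsFiniteMeasure lam]
    (hreg : lam.InnerRegularWRT (fun K => IsCompact K ∧ MeasurableSet K) MeasurableSet)
    {E : ℕ → Set X} (hE : ∀ n, MeasurableSet (E n)) (hcov : lam (⋃ n, E n)ᶜ = 0) :
    ∃ G : Set (Set X), IsLambdaPartition lam G ∧ ∀ I ∈ G, ∃ n, I ⊆ E n := by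
  have hdm : ∀ n, MeasurableSet (disjointed E n) := fun n => .disjointed hE n
  choose D hDE hDm hDs hDl using fun n => exists_isSigmaCompact_subset_measure_eq hreg (hdm n)
  refine ⟨D '' {n | 0 < lam (D n)}, ⟨(to_countable _).image D, ?_, ?_, ?_, ?_, ?_, ?_⟩, ?_⟩
  · rintro _ ⟨i, -, rfl⟩ _ ⟨j, -, rfl⟩ hij
    exact (disjoint_disjointed E (fun h => hij (by rw [h]))).mono (hDE i) (hDE j)
  · rintro _ ⟨i, -, rfl⟩; exact hDm i
  · rintro _ ⟨i, -, rfl⟩; exact hDs i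
  · rintro _ ⟨i, hi, rfl⟩; exact hi
  · rintro _ ⟨i, -, rfl⟩; exact measure_lt_top _ _
  · have hnull : ∀ n, lam (disjointed E n \ D n) = 0 := fun n => by
      rw [measure_sdiff (hDE n) (hDm n).nullMeasurableSet (measure_ne_top _ _), hDl n, tsub_self]
    -- The null pieces `D n` are left out of the partition; their union is still null.
    have hnull' : ∀ n, lam (if 0 < lam (D n) then ∅ else D n) = 0 := fun n => by
      split_ifs with h
      · exact measure_empty
      · simpa using h
    refine measure_mono_null ?_ (measure_union_null hcov (measure_union_null
      (measure_iUnion_null hnull) (measure_iUnion_null hnull')))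
    intro x hx
    by_cases hxE : x ∈ ⋃ n, E n
    · rw [← iUnion_disjointed] at hxE
      obtain ⟨n, hn⟩ := mem_iUnion.1 hxE
      right
      by_cases hxD : x ∈ D n
      · right
        refine mem_iUnion.2 ⟨n, ?_⟩
        rw [if_neg]
        · exact hxD
        · exact fun h => hx ⟨D n, ⟨n, h, rfl⟩, hxD⟩
      · exact Or.inl (mem_iUnion.2 ⟨n, hn, hxD⟩)
    · exact Or.inl hxE
  · rintro _ ⟨i, -, rfl⟩
    exact ⟨i, (hDE i).trans (disjointed_subset E i)⟩

/-- A density with values in `[C⁻¹, C]` on `I` has distortion bounded by `C ^ 2` there. -/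
theorem hasDistortionBoundedBy_of_density {μ : Measure X} [IsFiniteMeasure lam] (hac : μ ≪ lam)
    {I : Set X} {C K : ℝ≥0} (hC : C ≠ 0) (hCK : C ^ 2 ≤ K) (hI : MeasurableSet I)
    (hI0 : lam I ≠ 0)
    (hlow : ∀ A ⊆ I, MeasurableSet A → (C : ℝ≥0∞)⁻¹ * lam A ≤ μ A)
    (hup : ∀ A ⊆ I, MeasurableSet A → μ A ≤ C * lam A) :
    HasDistortionBoundedBy lam μ I K := by
  have hIfin : lam I ≠ ∞ := measure_ne_top _ _
  have hC' : (C : ℝ≥0∞) ≠ 0 := ENNReal.coe_ne_zero.2 hC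
  have hCK' : (C : ℝ≥0∞) * C ≤ K := by rw [← pow_two]; exact_mod_cast hCK
  have hlow' := hlow I subset_rfl hI
  have hup' := hup I subset_rfl hI
  refine ⟨hac, hup'.trans_lt (ENNReal.mul_lt_top ENNReal.coe_lt_top hIfin.lt_top), ?_, ?_⟩
  · intro A hAI hA
    calc (K : ℝ≥0∞)⁻¹ * (lam A / lam I) ≤ ((C : ℝ≥0∞) * C)⁻¹ * (lam A / lam I) := by gcongr
      _ = ((C : ℝ≥0∞)⁻¹ * lam A) / (C * lam I) := by
          rw [ENNReal.mul_inv (Or.inl hC') (Or.inl ENNReal.coe_ne_top), div_eq_mul_inv,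
            div_eq_mul_inv, ENNReal.mul_inv (Or.inl hC') (Or.inl ENNReal.coe_ne_top)]
          ring
      _ ≤ μ A / μ I := ENNReal.div_le_div (hlow A hAI hA) hup'
  · intro A hAI hA
    calc μ A / μ I ≤ (C * lam A) / ((C : ℝ≥0∞)⁻¹ * lam I) :=
          ENNReal.div_le_div (hup A hAI hA) hlow'
      _ = C * C * (lam A / lam I) := by
          rw [div_eq_mul_inv, div_eq_mul_inv, ENNReal.mul_inv (Or.inr hIfin) (Or.inr hI0), inv_inv]
          ring
      _ ≤ K * (lam A / lam I) := by gcongr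

/-- Every push-forward of `μ` under an iterate is `μ`, so the distortion for all `n` is that of the
single density `h`. -/
theorem IsAcim.exists_measMs_nonempty [TopologicalSpace X] [IsFiniteMeasure lam]
    (hreg : lam.InnerRegularWRT (fun K => IsCompact K ∧ MeasurableSet K) MeasurableSet)
    (herg : QuasiErgodic f lam) (hcons : Conservative f lam) {μ : Measure X}
    (hμ : IsAcim lam f μ) :
    ∃ G : Set (Set X), IsLambdaPartition lam G ∧ (MeasMs lam G f).Nonempty := by
  have := hμ.sigmaFinite
  have hac := hμ.absolutelyContinuous
  have hac' := hμ.absolutelyContinuous_symm herg hcons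
  set h := μ.rnDeriv lam with hh
  have hhm : Measurable h := Measure.measurable_rnDeriv _ _
  have hμh : lam.withDensity h = μ := Measure.withDensity_rnDeriv_eq _ _ hac
  set C : ℕ → ℝ≥0 := fun n => (n : ℝ≥0) + 1 with hCdef
  set E : ℕ → Set X := fun n => h ⁻¹' Icc ((C n : ℝ≥0∞)⁻¹) (C n) with hE
  have hEm : ∀ n, MeasurableSet (E n) := fun n => hhm measurableSet_Icc
  -- `lam ≪ μ` makes `h` positive almost everywhere, σ-finiteness makes it finite.
  have hcov : lam (⋃ n, E n)ᶜ = 0 := by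
    rw [measure_eq_zero_iff_ae_notMem]
    filter_upwards [Measure.rnDeriv_pos' hac', Measure.rnDeriv_lt_top μ lam] with x hx0 hxt
    rw [notMem_compl_iff, mem_iUnion]
    obtain ⟨a, ha⟩ := ENNReal.exists_nat_gt hxt.ne
    obtain ⟨b, hb⟩ := ENNReal.exists_nat_gt (ENNReal.inv_ne_top.2 hx0.ne')
    refine ⟨a + b, ?_, ?_⟩
    · rw [ENNReal.inv_le_iff_inv_le]
      refine hb.le.trans ?_
      simp only [hCdef]
      norm_cast
      omega
    · refine ha.le.trans ?_
      simp only [hCdef]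
      norm_cast
      omega
  obtain ⟨G, hG, hGE⟩ := exists_isLambdaPartition_of_iUnion hreg hEm hcov
  have hpre : ∀ I ∈ G, ∀ n, μ (f^[n] ⁻¹' I) = μ I := fun I hI n =>
    (hμ.invariant.iterate n).measure_preimage (hG.measurableSet I hI).nullMeasurableSet
  have hbd : ∀ I ∈ G, ∃ n, ∀ A ⊆ I, MeasurableSet A →
      (C n : ℝ≥0∞)⁻¹ * lam A ≤ μ A ∧ μ A ≤ C n * lam A := by
    intro I hI
    obtain ⟨n, hn⟩ := hGE I hI
    refine ⟨n, fun A hAI hA => ?_⟩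
    rw [← hμh, withDensity_apply _ hA, ← setLIntegral_const, ← setLIntegral_const]
    exact ⟨setLIntegral_mono hhm fun x hx => (hn (hAI hx)).1,
      setLIntegral_mono measurable_const fun x hx => (hn (hAI hx)).2⟩
  have hfin : ∀ I ∈ G, μ I < ∞ := fun I hI => by
    obtain ⟨n, hn⟩ := hbd I hI
    exact (hn I subset_rfl (hG.measurableSet I hI)).2.trans_lt
      (ENNReal.mul_lt_top ENNReal.coe_lt_top (measure_lt_top _ _))
  refine ⟨G, hG, μ, ⟨hμ.sigmaFinite, fun I hI => ?_⟩, fun I hI => ?_⟩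
  · have hIm := hG.measurableSet I hI
    have hI0 := (hG.measure_pos I hI).ne'
    have hμI0 : μ I ≠ 0 := fun h0 => hI0 (hac' h0)
    obtain ⟨n, hn⟩ := hbd I hI
    obtain ⟨a, ha⟩ : ∃ a : ℝ≥0, (a : ℝ≥0∞) = μ I := ⟨_, ENNReal.coe_toNNReal (hfin I hI).ne⟩
    have ha0 : a ≠ 0 := fun h0 => hμI0 (by rw [← ha, h0, ENNReal.coe_zero])
    have hCn : C n ≠ 0 := by simp [hCdef]
    -- `C n ^ 2` serves the distortion bound, `a` and `a⁻¹` the two sides of m1.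
    refine ⟨C n ^ 2 + a + a⁻¹, by positivity, ⟨?_, ?_⟩, fun k => ⟨?_, ?_, ?_⟩⟩
    · rw [ENNReal.inv_le_iff_inv_le, ← ha, ← ENNReal.coe_inv ha0, ENNReal.coe_le_coe]
      exact le_add_self
    · rw [← ha, ENNReal.coe_le_coe, add_right_comm]
      exact le_add_self
    · rw [hpre I hI]; exact pos_iff_ne_zero.2 hμI0
    · rw [hpre I hI]; exact hfin I hI
    · rw [(hμ.invariant.iterate k).map_eq]
      refine hasDistortionBoundedBy_of_density hac hCn ?_ hIm hI0
        (fun A hAI hA => (hn A hAI hA).1) (fun A hAI hA => (hn A hAI hA).2)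
      rw [add_assoc]
      exact le_self_add
  · simp only [PropM3, hpre I hI, ciSup_const]
    exact hfin I hI

end Forward

/-- Measurability of `f` and quasi-invariance of `lam` (`f_* lam ≪ lam`) are part of both
`Conservative f lam` and `QuasiErgodic f lam`. -/
theorem corollary2p8 {X : Type*} [TopologicalSpace X] [SigmaCompactSpace X]
    [MeasurableSpace X] [BorelSpace X]
    (lam : Measure X) [IsProbabilityMeasure lam]
    (hreg : lam.InnerRegularWRT (fun K => IsCompact K ∧ MeasurableSet K) MeasurableSet)
    (f : X → X) (herg : QuasiErgodic f lam) (hcons : Conservative f lam) :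
    (∃ μ : Measure X, IsAcim lam f μ) ↔
      ∃ G : Set (Set X), IsLambdaPartition lam G ∧ (MeasMs lam G f).Nonempty := by
  constructor
  · rintro ⟨μ, hμ⟩
    exact hμ.exists_measMs_nonempty hreg herg hcons
  · rintro ⟨G, hG, μ, hμ⟩
    exact exists_isAcim_of_measMs herg hcons hG hμ
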